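/- All Hilbert spaces are complex and finite-dimensional, an alphabet is a non-empty finite set, and for an alphabet $\mathcal{A}$ we write $\mathsf{A}=\mathbb{C}^{\mathcal{A}}$ and identify $a\in\mathcal{A}$ with the density operator $|a\rangle\langle a|$. $\mathcal{L}(\mathsf{H})$ is the space of linear operators on $\mathsf{H}$, a channel is a completely positive trace-preserving linear map $\mathcal{L}(\mathsf{H})\to\mathcal{L}(\mathsf{H}')$, and $\|X\|_1=\operatorname{Tr}\sqrt{X^\dagger X}$. A QECM (quantum encryption of classical messages) is a triple $(K,E,D)$ of channels $K:\mathcal{L}(\mathbb{C})\to\mathcal{L}(\mathsf{K})$, $E:\mathcal{L}(\mathsf{K}\otimes\mathsf{M})\to\mathcal{L}(\mathsf{C})$, $D:\mathcal{L}(\mathsf{K}\otimes\mathsf{C})\to\mathcal{L}(\mathsf{M})$, for alphabets $\mathcal{K}$ (keys), $\mathcal{M}$ (messages) and a Hilbert space $\mathsf{C}$. Put $E_k(\rho)=E(k\otimes\rho)$ and $D_k(\rho)=D(k\otimes\rho)$, and let $\mathbb{E}_k$ denote the expectation over a key $k$ sampled with probability $\langle k|K(1)|k\rangle$. A QECMR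 (QECM with revocation) is a tuple $S=(K,E,D,R,V)$ where $(K,E,D)$ is a QECM and $R:\mathcal{L}(\mathsf{C})\to\mathcal{L}(\mathsf{R})$ and $V:\mathcal{L}(\mathsf{K}\otimes\mathsf{R})\to\mathcal{L}(\mathbb{C}^{\{0,1\}})$ are channels, for an alphabet $\mathcal{R}$. Put $\overline{V}_k(\rho)=\langle 1|V(k\otimes\rho)|1\rangle$. For real numbers $\epsilon,\delta,\eta$: - $S$ is $\epsilon$-correct if for all $m\in\mathcal{M}$ both $\mathbb{E}_k\langle m|D_k(E_k(m))|m\rangle\ge 1-\epsilon$ and $\mathbb{E}_k\overline{V}_k(R(E_k(m)))\ge 1-\epsilon$. - $S$ has $\delta$-revocation security if for all $m,m'\in\mathcal{M}$, every Hilbert space $\mathsf{A}$ and every channel $A:\mathcal{L}(\mathsf{C})\to\mathcal{L}(\mathsf{R}\otimes\mathsf{A})$, $$\mathbb{E}_k\,\tfrac12\left\|(\overline{V}_k\otimes\mathrm{Id}_{\mathsf{A}})\circ A\circ E_k(m-m')\right\|_1\le\delta.$$ - $(K,E,D)$ is $\eta$-encrypting if for all $m_0,m_1\in\mathcal{M}$,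 $\tfrac12\left\|\mathbb{E}_k E_k(m_0-m_1)\right\|_1\le\eta$. Corollary (revocation implies encryption). Let $S=(K,E,D,R,V)$ be an $\epsilon$-correct QECMR with $\delta$-revocation security. Then the QECM $(K,E,D)$ is $\sqrt{19\left(\sqrt{\delta}+2\sqrt[8]{\epsilon}\right)}$-encrypting. -/

import Mathlib

open scoped Kronecker MatrixOrder ComplexOrder

namespace QuantumRevocation

noncomputable section

/-- `Op ι` is the space `L(ℂ^ι)` of linear operators on the Hilbert space `ℂ^ι`, written as
matrices in its orthonormal (computational) basis.  All Hilbert spaces are finite-dimensional. The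
space `ℂ^ι ⊗ ℂ^κ` is `ℂ^(ι × κ)`, and `ℂ` is `ℂ^Unit`. -/
abbrev Op (ι : Type*) := Matrix ι ι ℂ

/-- The density operator `|a⟩⟨a|` of a computational basis state. -/
def basisState {ι : Type*} [DecidableEq ι] (a : ι) : Op ι := Matrix.single a a 1

/-- The Schatten 1-norm `‖X‖₁ = Tr √(X† X)`. -/
def traceNorm {ι : Type*} [Fintype ι] [DecidableEq ι] (X : Op ι) : ℝ :=
  (CFC.sqrt (X.conjTranspose * X)).trace.re

/-- The map `Φ ⊗ Id` on `L(ℂ^ι ⊗ ℂ^ζ)`: `Φ` is applied to the `ι`-block at each pair of indices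
`z, w : ζ`. -/
def tensorId {ι κ : Type*} (Φ : Op ι →ₗ[ℂ] Op κ) (ζ : Type*) : Op (ι × ζ) →ₗ[ℂ] Op (κ × ζ) where
  toFun X := Matrix.of fun p q => Φ (Matrix.of fun i j => X (i, p.2) (j, q.2)) p.1 q.1
  map_add' X Y := by
    ext p q
    exact congrFun (congrFun (Φ.map_add (Matrix.of fun i j => X (i, p.2) (j, q.2))
      (Matrix.of fun i j => Y (i, p.2) (j, q.2))) p.1) q.1
  map_smul' c X := by
    ext p q
    exact congrFun (congrFun (Φ.map_smul c (Matrix.of fun i j => X (i, p.2) (j, q.2))) p.1) q.1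

/-- The map `φ ⊗ Id : L(ℂ^ι ⊗ ℂ^ζ) → L(ℂ ⊗ ℂ^ζ) = L(ℂ^ζ)` for a linear functional `φ` on
`L(ℂ^ι)`. -/
def functionalTensorId {ι : Type*} (φ : Op ι →ₗ[ℂ] ℂ) (ζ : Type*) : Op (ι × ζ) →ₗ[ℂ] Op ζ where
  toFun X := Matrix.of fun z w => φ (Matrix.of fun i j => X (i, z) (j, w))
  map_add' X Y := by
    ext z w
    exact φ.map_add (Matrix.of fun i j => X (i, z) (j, w)) (Matrix.of fun i j => Y (i, z) (j, w))
  map_smul' c X := by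
    ext z w
    exact φ.map_smul c (Matrix.of fun i j => X (i, z) (j, w))

/-- A channel: a completely positive and trace-preserving linear map. The auxiliary Hilbert space
in complete positivity ranges over all `ℂ^n`. -/
structure IsChannel {ι κ : Type*} [Fintype ι] [Fintype κ] (Φ : Op ι →ₗ[ℂ] Op κ) : Prop where
  completelyPositive : ∀ (n : ℕ) (X : Op (ι × Fin n)),
    X.PosSemidef → (tensorId Φ (Fin n) X).PosSemidef
  tracePreserving : ∀ X : Op ι, (Φ X).trace = X.trace

/-- A quantum encryption of classical messages: key generation, encoding and decoding channels,
with keys `𝓚`, messages `𝓜` and ciphertext space `ℂ^𝓒`. -/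
structure QECM (𝓚 𝓜 𝓒 : Type*) [Fintype 𝓚] [DecidableEq 𝓚] [Fintype 𝓜] [DecidableEq 𝓜]
    [Fintype 𝓒] [DecidableEq 𝓒] where
  /-- key generation -/
  K : Op Unit →ₗ[ℂ] Op 𝓚
  /-- encoding -/
  E : Op (𝓚 × 𝓜) →ₗ[ℂ] Op 𝓒
  /-- decoding -/
  D : Op (𝓚 × 𝓒) →ₗ[ℂ] Op 𝓜
  isChannel_K : IsChannel K
  isChannel_E : IsChannel E
  isChannel_D : IsChannel D

/-- A quantum encoding of classical messages with revocation: a QECM with an unkeyed revocation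
channel `R` and a keyed verification channel `V` that outputs one qubit. The revocation token space
is `ℂ^𝓡`, and `true` is the accepting state of the qubit. -/
structure QECMR (𝓚 𝓜 𝓒 𝓡 : Type*) [Fintype 𝓚] [DecidableEq 𝓚] [Fintype 𝓜] [DecidableEq 𝓜]
    [Fintype 𝓒] [DecidableEq 𝓒] [Fintype 𝓡] [DecidableEq 𝓡] extends QECM 𝓚 𝓜 𝓒 where
  /-- revocation -/
  R : Op 𝓒 →ₗ[ℂ] Op 𝓡
  /-- verification -/
  V : Op (𝓚 × 𝓡) →ₗ[ℂ] Op Bool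
  isChannel_R : IsChannel R
  isChannel_V : IsChannel V

section Schemes

variable {𝓚 𝓜 𝓒 𝓡 : Type*} [Fintype 𝓚] [DecidableEq 𝓚] [Fintype 𝓜] [DecidableEq 𝓜]
  [Fintype 𝓒] [DecidableEq 𝓒] [Fintype 𝓡] [DecidableEq 𝓡]

namespace QECM

/-- The probability `⟨k| K(ε) |k⟩` of sampling the key `k`, where the empty input is the unique
density operator `1` on `ℂ`. -/
def keyProb (S : QECM 𝓚 𝓜 𝓒) (k : 𝓚) : ℝ := (S.K 1 k k).re

/-- `E_k(ρ) = E(|k⟩⟨k| ⊗ ρ)`. -/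
def Ek (S : QECM 𝓚 𝓜 𝓒) (k : 𝓚) (ρ : Op 𝓜) : Op 𝓒 := S.E (basisState k ⊗ₖ ρ)

/-- `D_k(ρ) = D(|k⟩⟨k| ⊗ ρ)`. -/
def Dk (S : QECM 𝓚 𝓜 𝓒) (k : 𝓚) (ρ : Op 𝓒) : Op 𝓜 := S.D (basisState k ⊗ₖ ρ)

/-- Every message is recovered with probability at least `1 - ε`, averaged over the key. -/
def IsCorrect (S : QECM 𝓚 𝓜 𝓒) (ε : ℝ) : Prop :=
  ∀ m : 𝓜, 1 - ε ≤ ∑ k, S.keyProb k * (S.Dk k (S.Ek k (basisState m)) m m).re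

/-- The key-averaged ciphertexts of any two messages are within trace distance `δ`. -/
def IsEncrypting (S : QECM 𝓚 𝓜 𝓒) (δ : ℝ) : Prop :=
  ∀ m₀ m₁ : 𝓜,
    1 / 2 * traceNorm (∑ k, (S.keyProb k : ℂ) • S.Ek k (basisState m₀ - basisState m₁)) ≤ δ

end QECM

namespace QECMR

/-- The functional `ρ ↦ ⟨1| V(|k⟩⟨k| ⊗ ρ) |1⟩`. -/
def acceptMap (S : QECMR 𝓚 𝓜 𝓒 𝓡) (k : 𝓚) : Op 𝓡 →ₗ[ℂ] ℂ where
  toFun ρ := S.V (basisState k ⊗ₖ ρ) true true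
  map_add' ρ σ := by rw [Matrix.kronecker_add, map_add, Matrix.add_apply]
  map_smul' c ρ := by rw [Matrix.kronecker_smul, map_smul, Matrix.smul_apply, RingHom.id_apply]

/-- Correctness of the underlying QECM, and honest revocation tokens are accepted with probability
at least `1 - ε`, averaged over the key. -/
def IsCorrect (S : QECMR 𝓚 𝓜 𝓒 𝓡) (ε : ℝ) : Prop :=
  S.toQECM.IsCorrect ε ∧
    ∀ m : 𝓜, 1 - ε ≤ ∑ k, S.keyProb k * (S.acceptMap k (S.R (S.Ek k (basisState m)))).re

/-- `δ`-revocation security, against all channels `A : L(ℂ^𝓒) → L(ℂ^𝓡 ⊗ ℂ^d)` for all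
dimensions `d`. -/
def HasRevocationSecurity (S : QECMR 𝓚 𝓜 𝓒 𝓡) (δ : ℝ) : Prop :=
  ∀ (m m' : 𝓜) (d : ℕ) (A : Op 𝓒 →ₗ[ℂ] Op (𝓡 × Fin d)), IsChannel A →
    ∑ k, S.keyProb k * (1 / 2 * traceNorm (functionalTensorId (S.acceptMap k) (Fin d)
      (A (S.Ek k (basisState m - basisState m'))))) ≤ δ

end QECMR

end Schemes

end

end QuantumRevocation

open scoped Kronecker MatrixOrder ComplexOrder

namespace QuantumRevocation

noncomputable section

/-! ### Trace norm and the sign reflection of a Hermitian operator. -/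

section TraceNorm

variable {ι : Type*} [Fintype ι] [DecidableEq ι]

/-! Let `η` be the trace distance of two averaged ciphertexts and `U` the sign of their difference.
The adversary measures `U` weakly, with Kraus operators proportional to `1 ± η U`, honestly revokes
what remains, and keeps the outcome. The measurement is gentle: the averaged post-measurement state
dominates `(1 + η²)⁻¹ ρ`, so acceptance stays at least `(1 - ε) / (1 + η²)`
(`le_sum_acceptProb_weakKraus`). The outcome is nevertheless biased by `η / (1 + η²) · tr (U ρ)`
(`trace_weakKraus_mul_mul`). Revocation security bounds the resulting advantage
(`sum_abs_acceptProb_sub_le`), giving `(η² - ε) / (1 + η²) ≤ δ`. As `η ≤ 1`, this yields `η² ≤ 2 (δ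
+ ε)`, stronger than needed. -/

theorem traceNorm_eq_of_mul_self {X Y : Op ι} (hY : Y.PosSemidef) (h : Y * Y = X.conjTranspose * X) :
    traceNorm X = Y.trace.re := by
  rw [traceNorm, CFC.sqrt_unique h hY.nonneg]

theorem traceNorm_nonneg (X : Op ι) : 0 ≤ traceNorm X := by
  have h : (CFC.sqrt (X.conjTranspose * X)).PosSemidef :=
    Matrix.nonneg_iff_posSemidef.mp (CFC.sqrt_nonneg _)
  exact (Complex.le_def.mp h.trace_nonneg).1

theorem traceNorm_diagonal (f : ι → ℂ) : traceNorm (Matrix.diagonal f) = ∑ i, ‖f i‖ := by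
  rw [traceNorm_eq_of_mul_self (Y := Matrix.diagonal fun i => (‖f i‖ : ℂ))]
  · simp [Matrix.trace_diagonal]
  · rw [Matrix.posSemidef_diagonal_iff]
    intro i
    exact_mod_cast norm_nonneg (f i)
  · rw [Matrix.diagonal_conjTranspose, Matrix.diagonal_mul_diagonal, Matrix.diagonal_mul_diagonal]
    congr 1
    funext i
    rw [Pi.star_apply, Complex.star_def, Complex.conj_mul', sq]

/-- A Hermitian operator attains its trace norm against a Hermitian reflection. -/
theorem exists_reflection_trace_mul {X : Op ι} (hX : X.IsHermitian) :
    ∃ U : Op ι, U.IsHermitian ∧ U * U = 1 ∧ (U * X).trace.re = traceNorm X := by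
  have hXs : IsSelfAdjoint X := hX
  -- The value at `0` must be `1`, not `0`, so that `s` squares to `1` on the kernel too.
  let s : ℝ → ℝ := fun x => if 0 ≤ x then 1 else -1
  have hfin : (spectrum ℝ X).Finite := Matrix.finite_real_spectrum
  -- A finite spectrum admits the discontinuous `s` in the functional calculus.
  have hc (f : ℝ → ℝ) : ContinuousOn f (spectrum ℝ X) := hfin.continuousOn f
  have hs : ∀ x, s x * s x = 1 := fun x => by by_cases h : 0 ≤ x <;> simp [s, h]
  have hsx : ∀ x, 0 ≤ s x * x := fun x => by
    by_cases h : 0 ≤ x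
    · simp [s, h]
    · simp only [s, h, if_false]; linarith
  have hUX : cfc s X * X = cfc (fun x => s x * x) X := by
    rw [cfc_mul s (fun x => x) X (hc _) (hc _), cfc_id' ℝ X]
  refine ⟨cfc s X, cfc_predicate s X, ?_, ?_⟩
  · rw [← cfc_mul s s X (hc _) (hc _)]
    simp only [hs]
    exact cfc_const_one ℝ X
  · rw [hUX]
    refine (traceNorm_eq_of_mul_self ?_ ?_).symm
    · exact Matrix.nonneg_iff_posSemidef.mp (cfc_nonneg fun x _ => hsx x)
    · rw [← cfc_mul _ _ X (hc _) (hc _), hX.eq]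
      have : (fun x => s x * x * (s x * x)) = fun x => x * x := by
        funext x
        rw [mul_mul_mul_comm, hs, one_mul]
      rw [this, cfc_mul (fun x : ℝ => x) (fun x => x) X (hc _) (hc _), cfc_id' ℝ X]

end TraceNorm

/-! ### Channels that measure and record the outcome. -/

section Channels

variable {ι κ : Type*} [Fintype ι] [Fintype κ]

theorem posSemidef_blockDiagonal {n : Type*} [Fintype n] [DecidableEq n] {Y : n → Op ι}
    (hY : ∀ b, (Y b).PosSemidef) : (Matrix.blockDiagonal Y).PosSemidef := by
  classical
  choose B hB using fun b =>
    CStarAlgebra.nonneg_iff_eq_star_mul_self.mp (hY b).nonneg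
  obtain rfl : Y = fun b => (B b).conjTranspose * B b := funext hB
  rw [Matrix.blockDiagonal_mul, ← Matrix.blockDiagonal_conjTranspose]
  exact Matrix.posSemidef_conjTranspose_mul_self _

theorem IsChannel.map_posSemidef {Φ : Op ι →ₗ[ℂ] Op κ} (hΦ : IsChannel Φ) {X : Op ι}
    (hX : X.PosSemidef) : (Φ X).PosSemidef :=
  (hΦ.completelyPositive 1 _ (hX.submatrix Prod.fst)).submatrix fun i => (i, (0 : Fin 1))

theorem posSemidef_basisState {ι : Type*} [Fintype ι] [DecidableEq ι] (a : ι) :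
    (basisState a).PosSemidef := by
  rw [basisState, ← Matrix.diagonal_single, Matrix.posSemidef_diagonal_iff]
  intro i
  by_cases h : i = a
  · subst h; simp
  · simp [h]

theorem trace_basisState {ι : Type*} [Fintype ι] [DecidableEq ι] (a : ι) :
    (basisState a).trace = 1 := by
  simp [basisState]

/-- Measure with Kraus operators `M b`, apply `Φ` to the post-measurement state, and record the
outcome `b`. -/
def measureThen {d : ℕ} (Φ : Op ι →ₗ[ℂ] Op κ) (M : Fin d → Op ι) :
    Op ι →ₗ[ℂ] Op (κ × Fin d) where
  toFun ρ := Matrix.of fun p q =>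
    if p.2 = q.2 then Φ (M p.2 * ρ * (M p.2).conjTranspose) p.1 q.1 else 0
  map_add' X Y := by
    ext p q
    by_cases h : p.2 = q.2 <;> simp [h, mul_add, add_mul]
  map_smul' c X := by
    ext p q
    by_cases h : p.2 = q.2 <;> simp [h]

/-- The recorded outcome is classical, so the trace norm in the security definition becomes a sum of
moduli over outcomes. -/
theorem functionalTensorId_measureThen {ι κ : Type*} [Fintype ι] {d : ℕ}
    (Φ : Op ι →ₗ[ℂ] Op κ) (M : Fin d → Op ι) (φ : Op κ →ₗ[ℂ] ℂ) (ρ : Op ι) :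
    functionalTensorId φ (Fin d) (measureThen Φ M ρ) =
      Matrix.diagonal fun b => φ (Φ (M b * ρ * (M b).conjTranspose)) := by
  ext z w
  by_cases h : z = w
  · subst h
    simp only [functionalTensorId, measureThen, LinearMap.coe_mk, AddHom.coe_mk, Matrix.of_apply,
      if_true, Matrix.diagonal_apply_eq]
    rfl
  · simp only [functionalTensorId, measureThen, LinearMap.coe_mk, AddHom.coe_mk, Matrix.of_apply,
      h, if_false, Matrix.diagonal_apply_ne _ h]
    exact φ.map_zero

/-- Up to reordering indices, the extended output is block diagonal over the outcomes, each block
being `Φ ⊗ Id` of a conjugate of `X`. Trace preservation is cyclicity plus completeness of the Kraus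
operators. -/
theorem isChannel_measureThen [DecidableEq ι] {d : ℕ} {Φ : Op ι →ₗ[ℂ] Op κ} (hΦ : IsChannel Φ)
    {M : Fin d → Op ι} (hM : ∑ b, (M b).conjTranspose * M b = 1) :
    IsChannel (measureThen Φ M) where
  completelyPositive n X hX := by
    have hY (b : Fin d) : (tensorId Φ (Fin n) ((M b ⊗ₖ (1 : Op (Fin n))) * X *
        (M b ⊗ₖ (1 : Op (Fin n))).conjTranspose)).PosSemidef :=
      hΦ.completelyPositive n _ (hX.mul_mul_conjTranspose_same _)
    have hblock (b : Fin d) (z w : Fin n) :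
        (Matrix.of fun i j => ((M b ⊗ₖ (1 : Op (Fin n))) * X *
          (M b ⊗ₖ (1 : Op (Fin n))).conjTranspose) (i, z) (j, w)) =
        M b * (Matrix.of fun i j => X (i, z) (j, w)) * (M b).conjTranspose := by
      ext i j
      simp [Matrix.mul_apply, Fintype.sum_prod_type, Matrix.one_apply, Finset.sum_mul,
        apply_ite]
    have hsum : tensorId (measureThen Φ M) (Fin n) X =
        (Matrix.blockDiagonal fun b => tensorId Φ (Fin n) ((M b ⊗ₖ (1 : Op (Fin n))) * X *
          (M b ⊗ₖ (1 : Op (Fin n))).conjTranspose)).submatrix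
            (fun p : (κ × Fin d) × Fin n => ((p.1.1, p.2), p.1.2))
            (fun p => ((p.1.1, p.2), p.1.2)) := by
      ext p q
      simp only [tensorId, measureThen, LinearMap.coe_mk, AddHom.coe_mk, Matrix.of_apply,
        Matrix.submatrix_apply, Matrix.blockDiagonal_apply, hblock]
    rw [hsum]
    exact (posSemidef_blockDiagonal hY).submatrix _
  tracePreserving X := by
    have h : (measureThen Φ M X).trace =
        ∑ b, (Φ (M b * X * (M b).conjTranspose)).trace := by
      simp only [Matrix.trace, Matrix.diag_apply, Fintype.sum_prod_type]
      rw [Finset.sum_comm]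
      simp [measureThen]
    rw [h]
    simp only [hΦ.tracePreserving, Matrix.trace_mul_cycle _ X]
    rw [← Matrix.trace_sum, ← Finset.sum_mul, hM, one_mul]

end Channels

/-! ### Weak measurement of a reflection. -/

section Reflection

variable {ι : Type*} [Fintype ι] [DecidableEq ι]

/-- The Kraus operators `(1 ± η U) / √(2 (1 + η²))` of a measurement of the reflection `U` with
strength controlled by `η`. -/
def weakKraus (U : Op ι) (η : ℝ) (b : Fin 2) : Op ι :=
  ((√(2 * (1 + η ^ 2)))⁻¹ : ℂ) • (1 + (((-1) ^ (b : ℕ) * η : ℝ) : ℂ) • U)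

theorem conjTranspose_weakKraus {ι : Type*} [DecidableEq ι] {U : Op ι} (hU : U.IsHermitian)
    (η : ℝ) (b : Fin 2) : (weakKraus U η b).conjTranspose = weakKraus U η b := by
  simp [weakKraus, Matrix.conjTranspose_smul, Matrix.conjTranspose_add, hU.eq]

theorem weakKraus_mul_mul (U ρ : Op ι) (η : ℝ) (b : Fin 2) :
    weakKraus U η b * ρ * weakKraus U η b = ((2 * (1 + η ^ 2))⁻¹ : ℂ) •
      (ρ + (((-1) ^ (b : ℕ) * η : ℝ) : ℂ) • (U * ρ + ρ * U) + ((η ^ 2 : ℝ) : ℂ) • (U * ρ * U)) := by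
  have h : ((√(2 * (1 + η ^ 2)))⁻¹ : ℂ) * ((√(2 * (1 + η ^ 2)))⁻¹ : ℂ)
      = ((2 * (1 + η ^ 2))⁻¹ : ℂ) := by
    rw [← mul_inv, ← Complex.ofReal_mul, Real.mul_self_sqrt (by positivity)]
    push_cast
    rfl
  have h2 : (((-1) ^ (b : ℕ) * η : ℝ) : ℂ) * (((-1) ^ (b : ℕ) * η : ℝ) : ℂ) = ((η ^ 2 : ℝ) : ℂ) := by
    rw [← Complex.ofReal_mul]
    congr 1
    rw [mul_mul_mul_comm, ← mul_pow]
    simp [sq]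
  rw [weakKraus, Matrix.smul_mul, Matrix.smul_mul, Matrix.mul_smul, smul_smul, h]
  congr 1
  simp only [Matrix.smul_mul, Matrix.mul_smul, smul_smul, Matrix.add_mul, Matrix.mul_add,
    Matrix.one_mul, Matrix.mul_one, h2, smul_add]
  abel

/-- The cross terms `U ρ + ρ U` carry opposite signs and cancel; the disturbance is only of order
`η²`. -/
theorem sum_weakKraus_mul_mul (U ρ : Op ι) (η : ℝ) :
    ∑ b, weakKraus U η b * ρ * weakKraus U η b =
      ((1 + η ^ 2)⁻¹ : ℂ) • (ρ + ((η ^ 2 : ℝ) : ℂ) • (U * ρ * U)) := by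
  rw [Fin.sum_univ_two, weakKraus_mul_mul, weakKraus_mul_mul, ← smul_add]
  have h : ((1 + η ^ 2)⁻¹ : ℂ) = (2 * (1 + η ^ 2) : ℂ)⁻¹ * 2 := by
    rw [mul_inv]; ring
  rw [h, mul_smul, two_smul]
  congr 1
  simp
  abel

theorem sum_weakKraus_mul_self {U : Op ι} (hUU : U * U = 1) (η : ℝ) :
    ∑ b, weakKraus U η b * weakKraus U η b = 1 := by
  have h := sum_weakKraus_mul_mul U 1 η
  simp only [Matrix.mul_one, hUU] at h
  rw [h, ← one_smul ℂ (1 : Op ι), smul_smul, ← add_smul, smul_smul]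
  congr 1
  have : (1 + η ^ 2 : ℂ) ≠ 0 := by
    have : (1 + η ^ 2 : ℝ) ≠ 0 := by positivity
    exact_mod_cast this
  push_cast
  rw [mul_one, inv_mul_cancel₀ this]

theorem trace_weakKraus_mul_mul {U : Op ι} (hUU : U * U = 1) (ρ : Op ι) (η : ℝ) (b : Fin 2) :
    (weakKraus U η b * ρ * weakKraus U η b).trace.re =
      ρ.trace.re / 2 + (-1) ^ (b : ℕ) * (η / (1 + η ^ 2)) * (U * ρ).trace.re := by
  have h : ((2 * (1 + η ^ 2))⁻¹ : ℂ) = (((2 * (1 + η ^ 2))⁻¹ : ℝ) : ℂ) := by push_cast; rfl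
  rw [weakKraus_mul_mul, Matrix.trace_smul, Matrix.trace_add, Matrix.trace_add, Matrix.trace_smul,
    Matrix.trace_smul, Matrix.trace_add, Matrix.trace_mul_comm ρ U, Matrix.trace_mul_cycle, hUU,
    one_mul, h]
  simp only [smul_eq_mul, Complex.re_ofReal_mul, Complex.add_re]
  have : (1 + η ^ 2 : ℝ) ≠ 0 := by positivity
  field_simp
  ring

/-- At strength `1` the measurement is projective, and both outcome weights are nonnegative. -/
theorem trace_reflection_mul_le {U : Op ι} (hU : U.IsHermitian) (hUU : U * U = 1) {ρ : Op ι}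
    (hρ : ρ.PosSemidef) : |(U * ρ).trace.re| ≤ ρ.trace.re := by
  have key (b : Fin 2) : 0 ≤ (weakKraus U 1 b * ρ * weakKraus U 1 b).trace.re := by
    have h := hρ.mul_mul_conjTranspose_same (weakKraus U 1 b)
    rw [conjTranspose_weakKraus hU] at h
    exact (Complex.le_def.mp h.trace_nonneg).1
  have h0 := key 0
  have h1 := key 1
  rw [trace_weakKraus_mul_mul hUU] at h0 h1
  norm_num at h0 h1
  rw [abs_le]
  constructor <;> linarith

end Reflection

/-! ### Acceptance probabilities and the attack. -/

section Schemes

variable {𝓚 𝓜 𝓒 𝓡 : Type*} [Fintype 𝓚] [DecidableEq 𝓚] [Fintype 𝓜] [DecidableEq 𝓜]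
  [Fintype 𝓒] [DecidableEq 𝓒] [Fintype 𝓡] [DecidableEq 𝓡]

namespace QECM

theorem keyProb_nonneg (S : QECM 𝓚 𝓜 𝓒) (k : 𝓚) : 0 ≤ S.keyProb k :=
  (Complex.le_def.mp ((S.isChannel_K.map_posSemidef Matrix.PosSemidef.one).diag_nonneg)).1

theorem sum_keyProb (S : QECM 𝓚 𝓜 𝓒) : ∑ k, S.keyProb k = 1 := by
  have h := congrArg Complex.re (S.isChannel_K.tracePreserving 1)
  simpa [Matrix.trace, keyProb] using h

theorem Ek_sub (S : QECM 𝓚 𝓜 𝓒) (k : 𝓚) (ρ σ : Op 𝓜) :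
    S.Ek k (ρ - σ) = S.Ek k ρ - S.Ek k σ := by
  rw [Ek, Ek, Ek, ← map_sub]
  congr 1
  ext i j
  simp [mul_sub]

theorem posSemidef_Ek (S : QECM 𝓚 𝓜 𝓒) (k : 𝓚) {ρ : Op 𝓜} (hρ : ρ.PosSemidef) :
    (S.Ek k ρ).PosSemidef :=
  S.isChannel_E.map_posSemidef ((posSemidef_basisState k).kronecker hρ)

theorem trace_Ek (S : QECM 𝓚 𝓜 𝓒) (k : 𝓚) (ρ : Op 𝓜) : (S.Ek k ρ).trace = ρ.trace := by
  rw [Ek, S.isChannel_E.tracePreserving, Matrix.trace_kronecker, trace_basisState, one_mul]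

/-- The key-averaged ciphertext of the message `m`. -/
def averageCipher (S : QECM 𝓚 𝓜 𝓒) (m : 𝓜) : Op 𝓒 :=
  ∑ k, (S.keyProb k : ℂ) • S.Ek k (basisState m)

theorem posSemidef_averageCipher (S : QECM 𝓚 𝓜 𝓒) (m : 𝓜) : (S.averageCipher m).PosSemidef :=
  Matrix.posSemidef_sum _ fun k _ =>
    (S.posSemidef_Ek k (posSemidef_basisState m)).smul (by exact_mod_cast S.keyProb_nonneg k)

/-- Real parts of linear functionals commute with averaging over the key. -/
theorem re_averageCipher (S : QECM 𝓚 𝓜 𝓒) (f : Op 𝓒 →ₗ[ℂ] ℂ) (m : 𝓜) :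
    (f (S.averageCipher m)).re = ∑ k, S.keyProb k * (f (S.Ek k (basisState m))).re := by
  simp [averageCipher, map_sum]

theorem trace_averageCipher (S : QECM 𝓚 𝓜 𝓒) (m : 𝓜) : (S.averageCipher m).trace.re = 1 := by
  have h := S.re_averageCipher (Matrix.traceLinearMap 𝓒 ℂ ℂ) m
  simpa [trace_Ek, trace_basisState, sum_keyProb] using h

theorem sum_smul_Ek_sub (S : QECM 𝓚 𝓜 𝓒) (m₀ m₁ : 𝓜) :
    ∑ k, (S.keyProb k : ℂ) • S.Ek k (basisState m₀ - basisState m₁) =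
      S.averageCipher m₀ - S.averageCipher m₁ := by
  simp only [averageCipher, Ek_sub, smul_sub, Finset.sum_sub_distrib]

end QECM

namespace QECMR

theorem acceptMap_nonneg (S : QECMR 𝓚 𝓜 𝓒 𝓡) (k : 𝓚) {ρ : Op 𝓡} (hρ : ρ.PosSemidef) :
    0 ≤ (S.acceptMap k ρ).re :=
  (Complex.le_def.mp (S.isChannel_V.map_posSemidef
    ((posSemidef_basisState k).kronecker hρ)).diag_nonneg).1

theorem acceptMap_le_trace (S : QECMR 𝓚 𝓜 𝓒 𝓡) (k : 𝓚) {ρ : Op 𝓡} (hρ : ρ.PosSemidef) :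
    (S.acceptMap k ρ).re ≤ ρ.trace.re := by
  have hV := S.isChannel_V.map_posSemidef ((posSemidef_basisState k).kronecker hρ)
  have h := congrArg Complex.re (S.isChannel_V.tracePreserving (basisState k ⊗ₖ ρ))
  rw [Matrix.trace_kronecker, trace_basisState, one_mul, Matrix.trace, Fintype.sum_bool,
    Complex.add_re] at h
  have h0 := (Complex.le_def.mp (hV.diag_nonneg (i := false))).1
  simp only [Matrix.diag_apply, Complex.zero_re] at h h0
  change (S.V (basisState k ⊗ₖ ρ) true true).re ≤ _
  linarith

/-- The average probability that the token `R(L ρ L†)` is accepted, where `ρ` encrypts `m`. -/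
def acceptProb (S : QECMR 𝓚 𝓜 𝓒 𝓡) (L : Op 𝓒) (m : 𝓜) : ℝ :=
  ∑ k, S.keyProb k * (S.acceptMap k (S.R (L * S.Ek k (basisState m) * L.conjTranspose))).re

theorem acceptProb_le (S : QECMR 𝓚 𝓜 𝓒 𝓡) (L : Op 𝓒) (m : 𝓜) :
    S.acceptProb L m ≤ (L * S.averageCipher m * L.conjTranspose).trace.re := by
  have h := S.re_averageCipher (Matrix.traceLinearMap 𝓒 ℂ ℂ ∘ₗ
    (LinearMap.mulRight ℂ L.conjTranspose ∘ₗ LinearMap.mulLeft ℂ L)) m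
  simp only [LinearMap.comp_apply, LinearMap.mulLeft_apply, LinearMap.mulRight_apply,
    Matrix.traceLinearMap_apply] at h
  rw [h]
  refine Finset.sum_le_sum fun k _ => mul_le_mul_of_nonneg_left ?_ (S.keyProb_nonneg k)
  have hP := (S.posSemidef_Ek k (posSemidef_basisState m)).mul_mul_conjTranspose_same L
  refine (S.acceptMap_le_trace k (S.isChannel_R.map_posSemidef hP)).trans_eq ?_
  rw [S.isChannel_R.tracePreserving]

/-- A weak measurement of a reflection is gentle: the honest token made from the post-measurement
state is still accepted with high probability. -/
theorem le_sum_acceptProb_weakKraus (S : QECMR 𝓚 𝓜 𝓒 𝓡) {ε : ℝ} (hS : S.IsCorrect ε)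
    {U : Op 𝓒} (hU : U.IsHermitian) (η : ℝ) (m : 𝓜) :
    (1 + η ^ 2)⁻¹ * (1 - ε) ≤ ∑ b, S.acceptProb (weakKraus U η b) m := by
  have hpos : 0 ≤ (1 + η ^ 2)⁻¹ := by positivity
  refine (mul_le_mul_of_nonneg_left (hS.2 m) hpos).trans ?_
  simp only [acceptProb]
  rw [Finset.sum_comm, Finset.mul_sum]
  refine Finset.sum_le_sum fun k _ => ?_
  rw [← Finset.mul_sum, mul_left_comm]
  refine mul_le_mul_of_nonneg_left ?_ (S.keyProb_nonneg k)
  simp only [conjTranspose_weakKraus hU]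
  rw [← Complex.re_sum, ← map_sum, ← map_sum, sum_weakKraus_mul_mul]
  have hc : ((1 + η ^ 2)⁻¹ : ℂ) = (((1 + η ^ 2)⁻¹ : ℝ) : ℂ) := by push_cast; rfl
  simp only [hc, map_smul, map_add, smul_eq_mul, Complex.re_ofReal_mul, Complex.add_re]
  refine mul_le_mul_of_nonneg_left ?_ hpos
  have hP := (S.posSemidef_Ek k (posSemidef_basisState m)).mul_mul_conjTranspose_same U
  rw [hU.eq] at hP
  -- The `U ρ U` part can only add acceptance and is discarded.
  have := mul_nonneg (sq_nonneg η) (S.acceptMap_nonneg k (S.isChannel_R.map_posSemidef hP))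
  linarith

/-- Revocation security against the adversary that measures the ciphertext, returns the honest
token of the post-measurement state and keeps the outcome. -/
theorem HasRevocationSecurity.sum_abs_acceptProb_sub_le {S : QECMR 𝓚 𝓜 𝓒 𝓡} {δ : ℝ}
    (hS : S.HasRevocationSecurity δ) {d : ℕ} {M : Fin d → Op 𝓒}
    (hM : ∑ b, (M b).conjTranspose * M b = 1) (m m' : 𝓜) :
    1 / 2 * ∑ b, |S.acceptProb (M b) m - S.acceptProb (M b) m'| ≤ δ := by
  refine le_trans ?_ (hS m m' d _ (isChannel_measureThen S.isChannel_R hM))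
  simp only [functionalTensorId_measureThen, traceNorm_diagonal]
  simp only [mul_left_comm _ (1 / 2 : ℝ), ← Finset.mul_sum]
  refine mul_le_mul_of_nonneg_left ?_ (by norm_num)
  simp only [Finset.mul_sum]
  rw [Finset.sum_comm]
  refine Finset.sum_le_sum fun b _ => ?_
  rw [acceptProb, acceptProb, ← Finset.sum_sub_distrib]
  refine (Finset.abs_sum_le_sum_abs _ _).trans (Finset.sum_le_sum fun k _ => ?_)
  rw [← mul_sub, abs_mul, abs_of_nonneg (S.keyProb_nonneg k)]
  refine mul_le_mul_of_nonneg_left ?_ (S.keyProb_nonneg k)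
  rw [QECM.Ek_sub, Matrix.mul_sub, Matrix.sub_mul, map_sub, map_sub, ← Complex.sub_re]
  exact Complex.abs_re_le_norm _

theorem IsCorrect.nonneg {S : QECMR 𝓚 𝓜 𝓒 𝓡} {ε : ℝ} (hS : S.IsCorrect ε) (m : 𝓜) : 0 ≤ ε := by
  have h := S.acceptProb_le 1 m
  simp only [acceptProb, Matrix.conjTranspose_one, one_mul, mul_one, QECM.trace_averageCipher] at h
  linarith [hS.2 m]

/-- The trivial one-outcome measurement has advantage zero on equal messages. -/
theorem HasRevocationSecurity.nonneg {S : QECMR 𝓚 𝓜 𝓒 𝓡} {δ : ℝ} (hS : S.HasRevocationSecurity δ)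
    (m : 𝓜) : 0 ≤ δ := by
  have h := hS.sum_abs_acceptProb_sub_le (d := 1) (M := fun _ => 1) (by simp) m m
  simpa using h

/-- The trace distance of two key-averaged ciphertexts is at most `√(2 (δ + ε))`. -/
theorem sq_traceNorm_averageCipher_sub_le {S : QECMR 𝓚 𝓜 𝓒 𝓡} {ε δ : ℝ} (hc : S.IsCorrect ε)
    (hr : S.HasRevocationSecurity δ) (m₀ m₁ : 𝓜) :
    1 / 2 * traceNorm (S.averageCipher m₀ - S.averageCipher m₁) ≤ 1 ∧
      (1 / 2 * traceNorm (S.averageCipher m₀ - S.averageCipher m₁)) ^ 2 ≤ 2 * (δ + ε) := by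
  obtain ⟨U, hU, hUU, hUt⟩ := exists_reflection_trace_mul
    ((S.posSemidef_averageCipher m₀).isHermitian.sub (S.posSemidef_averageCipher m₁).isHermitian)
  -- The trace distance doubles as measurement strength: strength `t` gives advantage at least `(2tη
  -- - t² - ε) / (1 + t²)`, whose numerator peaks at `t = η`.
  set η : ℝ := 1 / 2 * traceNorm (S.averageCipher m₀ - S.averageCipher m₁) with hη
  rw [Matrix.mul_sub, Matrix.trace_sub, Complex.sub_re] at hUt
  have hη0 : 0 ≤ η := mul_nonneg (by norm_num) (traceNorm_nonneg _)
  have hη1 : η ≤ 1 := by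
    have h0 := abs_le.mp (trace_reflection_mul_le hU hUU (S.posSemidef_averageCipher m₀))
    have h1 := abs_le.mp (trace_reflection_mul_le hU hUU (S.posSemidef_averageCipher m₁))
    rw [QECM.trace_averageCipher] at h0 h1
    linarith [h0.2, h1.1]
  refine ⟨hη1, ?_⟩
  have hM : ∑ b, (weakKraus U η b).conjTranspose * weakKraus U η b = 1 := by
    simpa only [conjTranspose_weakKraus hU] using sum_weakKraus_mul_self hUU η
  have hsec := hr.sum_abs_acceptProb_sub_le hM m₀ m₁
  have hle (b : Fin 2) (m : 𝓜) : S.acceptProb (weakKraus U η b) m ≤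
      1 / 2 + (-1) ^ (b : ℕ) * (η / (1 + η ^ 2)) * (U * S.averageCipher m).trace.re := by
    have h := S.acceptProb_le (weakKraus U η b) m
    rwa [conjTranspose_weakKraus hU, trace_weakKraus_mul_mul hUU, QECM.trace_averageCipher] at h
  have hg₀ := S.le_sum_acceptProb_weakKraus hc hU η m₀
  have hg₁ := S.le_sum_acceptProb_weakKraus hc hU η m₁
  rw [Fin.sum_univ_two] at hsec hg₀ hg₁
  -- Only the outcomes pointing to the wrong message need upper bounds; the total acceptance bounds
  -- then handle the right ones from below.
  have h00 := hle 1 m₀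
  have h01 := hle 0 m₁
  norm_num at h00 h01
  have ha := le_abs_self
    (S.acceptProb (weakKraus U η 0) m₀ - S.acceptProb (weakKraus U η 0) m₁)
  have hb := neg_abs_le
    (S.acceptProb (weakKraus U η 1) m₀ - S.acceptProb (weakKraus U η 1) m₁)
  have hd : η / (1 + η ^ 2) * (U * S.averageCipher m₀).trace.re -
      η / (1 + η ^ 2) * (U * S.averageCipher m₁).trace.re = 2 * (1 - (1 + η ^ 2)⁻¹) := by
    rw [← mul_sub, hUt, show traceNorm (S.averageCipher m₀ - S.averageCipher m₁) = 2 * η by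
      rw [hη]; ring]
    have : (1 + η ^ 2 : ℝ) ≠ 0 := by positivity
    field_simp
    ring
  have hε := hc.nonneg m₀
  have hinv : (1 + η ^ 2)⁻¹ ≤ 1 := inv_le_one_of_one_le₀ (by nlinarith)
  have hfin : 1 - (1 + η ^ 2)⁻¹ ≤ δ + ε := by
    nlinarith [mul_nonneg hε (sub_nonneg.mpr hinv)]
  have hhalf : η ^ 2 / 2 ≤ 1 - (1 + η ^ 2)⁻¹ := by
    have h2 : (1 + η ^ 2 : ℝ) ≠ 0 := by positivity
    have : 1 - (1 + η ^ 2)⁻¹ - η ^ 2 / 2 = η ^ 2 * (1 - η ^ 2) / (2 * (1 + η ^ 2)) := by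
      field_simp
      ring
    have h3 : 0 ≤ η ^ 2 * (1 - η ^ 2) / (2 * (1 + η ^ 2)) := by
      have : 0 ≤ 1 - η ^ 2 := by nlinarith
      positivity
    linarith
  linarith

end QECMR

end Schemes

end

end QuantumRevocation

theorem mainTheorem7 {𝓚 𝓜 𝓒 𝓡 : Type*} [Fintype 𝓚] [DecidableEq 𝓚] [Fintype 𝓜] [DecidableEq 𝓜]
    [Fintype 𝓒] [DecidableEq 𝓒] [Fintype 𝓡] [DecidableEq 𝓡]
    (S : QuantumRevocation.QECMR 𝓚 𝓜 𝓒 𝓡) (ε δ : ℝ)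
    (hcorrect : S.IsCorrect ε) (hrevocation : S.HasRevocationSecurity δ) :
    S.toQECM.IsEncrypting (√(19 * (√δ + 2 * ε ^ (1 / 8 : ℝ)))) := by
  intro m₀ m₁
  rw [QuantumRevocation.QECM.sum_smul_Ek_sub]
  obtain ⟨h1, h2⟩ :=
    QuantumRevocation.QECMR.sq_traceNorm_averageCipher_sub_le hcorrect hrevocation m₀ m₁
  have hε := hcorrect.nonneg m₀
  have hδ := hrevocation.nonneg m₀
  have hp := Real.rpow_nonneg hε (1 / 8)
  have hq := Real.sqrt_nonneg δ
  have h0 := mul_nonneg (by norm_num : (0 : ℝ) ≤ 1 / 2) (QuantumRevocation.traceNorm_nonneg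
    (S.averageCipher m₀ - S.averageCipher m₁))
  refine Real.le_sqrt_of_sq_le ?_
  -- If `δ` or `ε` is at least `1`, the bound exceeds `1` and `η ≤ 1` suffices; otherwise `δ ≤ √δ`
  -- and `ε ≤ ε ^ (1/8)`.
  rcases le_total 1 δ with hδ1 | hδ1
  · have : 1 ≤ √δ := Real.one_le_sqrt.mpr hδ1
    nlinarith
  rcases le_total 1 ε with hε1 | hε1
  · have : 1 ≤ ε ^ (1 / 8 : ℝ) := Real.one_le_rpow hε1 (by norm_num)
    nlinarith
  have hδ' : δ ≤ √δ := Real.le_sqrt_of_sq_le (by nlinarith)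
  have hε' : ε ≤ ε ^ (1 / 8 : ℝ) := by
    simpa using Real.rpow_le_rpow_of_exponent_ge' hε hε1 (by norm_num) (by norm_num : (1 / 8 : ℝ) ≤ 1)
  linarith
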